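/- Let $\varepsilon>0$ and let $p\colon\mathbb N\to[0,1]$ satisfy $$p(n)>\left(\sqrt{\tfrac12}+\varepsilon\right)\sqrt{\frac{\log n}{n}}$$ for all sufficiently large $n$. Let $\Gamma\in\mathcal G(n,p)$ denote the Erdős–Rényi random graph on $n$ vertices, in which any two distinct vertices are joined by an edge with probability $p(n)$, independently of all other pairs. For $k\ge 3$, a $k$-cycle in a graph $\Gamma$ is a subgraph with $k$ distinct vertices $v_1,\dots,v_k$ whose edges are exactly $\{v_i,v_{i+1}\}$ $(1\le i\le k-1)$ and $\{v_k,v_1\}$. A subgraph $\Lambda\subseteq\Gamma$ is Morse if it is induced and, whenever $C$ is an induced $4$-cycle in $\Gamma$ such that $C\cap\Lambda$ contains two distinct non-adjacent vertices, $C\subseteq\Lambda$. A Morse $k$-cycle is a $k$-cycle that is a Morse subgraph. Then asymptotically almost surely $\Gamma$ contains no Morse $k$-cycle with $k\ge5$; that is, $$\lim_{n\to\infty}\mathbb P\bigl(\Gamma\in\mathcal G(n,p)\text{ contains no Morse }k\text{-cycle for any }k\ge5\bigr)=1.$$ -/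

import Mathlib

open Filter Topology

namespace SimpleGraph.Subgraph

variable {V : Type*} {G : SimpleGraph V}

/-- The subgraph `Λ` is a `k`-cycle: its vertices can be listed without repetition as
`v₁, …, v_k` (`k ≥ 3`) so that its edges are exactly the pairs `{v_i, v_{i+1}}` and
`{v_k, v₁}`. It need not be induced in `G`. -/
def IsKCycle (Λ : G.Subgraph) (k : ℕ) : Prop :=
  3 ≤ k ∧ Nonempty (Λ.coe ≃g SimpleGraph.cycleGraph k)

/-- A subgraph `Λ` of `G` is Morse if it is induced and contains every induced `4`-cycle `C` of `G`
that shares with `Λ` two (distinct) non-adjacent vertices. -/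
def IsMorse (Λ : G.Subgraph) : Prop :=
  Λ.IsInduced ∧
    ∀ C : G.Subgraph, C.IsInduced → C.IsKCycle 4 →
      (∃ v ∈ C.verts ∩ Λ.verts, ∃ w ∈ C.verts ∩ Λ.verts, v ≠ w ∧ ¬ G.Adj v w) → C ≤ Λ

/-- A Morse `k`-cycle: a Morse subgraph that is a `k`-cycle. -/
def IsMorseCycle (Λ : G.Subgraph) (k : ℕ) : Prop :=
  Λ.IsKCycle k ∧ Λ.IsMorse

end SimpleGraph.Subgraph

/-- Asymptotically almost surely: the probability that the Erdős–Rényi random graph on `n` labelled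
vertices, with each edge present independently with probability `p n`, has the property `P`
(a property of graphs on `n` vertices for each `n`) tends to `1` as `n → ∞`. -/
def AsymptoticallyAlmostSurely (p : ℕ → unitInterval)
    (P : ∀ n : ℕ, SimpleGraph (Fin n) → Prop) : Prop :=
  Tendsto (fun n : ℕ => SimpleGraph.binomialRandom (Fin n) (p n) {Γ | P n Γ}) atTop (𝓝 1)

namespace SimpleGraph

open MeasureTheory unitInterval

/-! ### Probability bounds for configurations in the binomial random graph -/

section Probability

variable {V : Type*} [Fintype V]

/-! Two non-adjacent common neighbours of a non-adjacent pair on a Morse cycle would complete an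
induced square, which the cycle must contain; a cycle of length at least 5 contains none. So every
such common neighbourhood is a clique (`exists_isCliqueLinkedCycle`), and it suffices to exclude
these cycles by union bounds, uniformly in `p`.

The constant √(1/2) comes from the sparse range, p of order √(log n / n). No outside vertex sees
exactly v_i and v_{i+2}. For fixed w these k events are disjoint, so a given k-cycle survives with
probability about exp(-k p² n) ≤ n^(-βk) for some β > 1/2, while there are at most (np)^k = n^(k/2 +
o(k)) expected cycles. Long cycles are replaced by a path of fixed length
(`real_hasCliqueLinkedCycle_le_sparse`).

For larger p it is enough that some pair has a clique as common neighbourhood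
(`real_hasCliqueLinkedCycle_le_clique`). For p extremely close to 1, five vertices with five missing
edges are already unlikely. -/

lemma binomialRandom_real_cylinder_le (p : I) {ι : Type*} [Fintype ι] {e : ι → Sym2 V}
    (he : Function.Injective e) (hd : ∀ i, ¬ (e i).IsDiag) (b : ι → Bool) :
    (binomialRandom V p).real {Γ | ∀ i, e i ∈ Γ.edgeSet ↔ b i} ≤
      ∏ i, if b i then (p : ℝ) else 1 - p := by
  classical
  have key : binomialRandom V p {Γ | ∀ i, e i ∈ Γ.edgeSet ↔ b i} ≤
      ∏ i, ((if b i then toNNReal p else toNNReal (σ p) : NNReal) : ENNReal) := by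
    rw [binomialRandom_apply]
    let t : Sym2 V → Set Prop := fun z ↦ {P | ∀ i, e i = z → (P ↔ b i)}
    calc _ ≤ _ := measure_mono (t := Set.pi (↑(Finset.univ.map ⟨e, he⟩)) t) ?_
      _ = _ := Measure.infinitePi_pi _ (by intros; exact DiscreteMeasurableSpace.forall_measurableSet _)
      _ ≤ _ := ?_
    · rintro _ ⟨Γ, hΓ, rfl⟩ z hz i rfl
      exact hΓ i
    · rw [Finset.prod_map]
      refine Finset.prod_le_prod' fun i _ ↦ ?_
      have h1 : (¬ (e i).IsDiag) = True := by simp [hd i]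
      have ht : t (e i) = {P | P ↔ b i} := by
        ext P
        constructor
        · intro h; exact h i rfl
        · intro h j hj
          rw [he hj]; exact h
      simp only [Function.Embedding.coeFn_mk, h1, ht]
      by_cases hb : b i <;> simp [hb]
  have := ENNReal.toReal_mono (by simp [ENNReal.prod_ne_top]) key
  rw [Measure.real]
  refine this.trans (le_of_eq ?_)
  rw [ENNReal.toReal_prod]
  refine Finset.prod_congr rfl fun i _ ↦ ?_
  split_ifs <;> simp

lemma one_sub_coe_nonneg (p : I) : (0 : ℝ) ≤ 1 - p := sub_nonneg.2 p.2.2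

lemma one_sub_pow_le_exp {x : ℝ} (hx : 0 ≤ 1 - x) (m : ℕ) : (1 - x) ^ m ≤ Real.exp (-(x * m)) := by
  refine (pow_le_pow_left₀ hx (Real.one_sub_le_exp_neg x) m).trans_eq ?_
  rw [← Real.exp_nat_mul]
  congr 1
  ring

/-- First moment bound for copies of a configuration on vertex set `κ`: a family `e` of edges, and
no outside vertex whose neighbourhood in the copy belongs to the family `F` of pairs. -/
lemma binomialRandom_real_pattern_le (p : I) {κ η : Type*} [Fintype κ] [DecidableEq κ] [Fintype η]
    {e : η → Sym2 κ} (he : Function.Injective e) (hd : ∀ i, ¬ (e i).IsDiag)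
    (F : Finset (Finset κ)) (hF : ∀ S ∈ F, S.card = 2) (f : κ ↪ V) :
    (binomialRandom V p).real {Γ | (∀ i, (e i).map f ∈ Γ.edgeSet) ∧
      ∀ w ∉ Set.range f, ∀ S ∈ F, ¬ ∀ i, Γ.Adj w (f i) ↔ i ∈ S} ≤
    (p : ℝ) ^ Fintype.card η *
      Real.exp (-(F.card * ((p : ℝ) ^ 2 * (1 - p) ^ (Fintype.card κ - 2)) *
        (Fintype.card V - Fintype.card κ : ℕ))) := by
  classical
  let W := {w : V // w ∉ Set.range f}
  -- `g` records the neighbourhood in the copy of every outside vertex. The union bound over all `g`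
  -- avoiding `F` loses nothing, since these cylinders are disjoint, and its sum factorises over the
  -- outside vertices.
  let G : Finset (W → Finset κ) := Fintype.piFinset fun _ ↦ Fᶜ
  let E : η ⊕ (W × κ) → Sym2 V := Sum.elim (fun i ↦ (e i).map f) (fun x ↦ s(x.1.1, f x.2))
  let b : (W → Finset κ) → η ⊕ (W × κ) → Bool :=
    fun g ↦ Sum.elim (fun _ ↦ true) (fun x ↦ decide (x.2 ∈ g x.1))
  have hE : Function.Injective E := by
    have hne : ∀ i (w : W) k, (e i).map f ≠ s(w.1, f k) := by
      intro i w k h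
      have : w.1 ∈ (e i).map f := by rw [h]; simp
      obtain ⟨a, -, ha⟩ := Sym2.mem_map.1 this
      exact w.2 ⟨a, ha⟩
    rintro (i | ⟨w, k⟩) (j | ⟨w', k'⟩) h
    · simp only [E, Sum.elim_inl] at h
      rw [he (Sym2.map.injective f.injective h)]
    · exact absurd h (hne _ _ _)
    · exact absurd h.symm (hne _ _ _)
    · simp only [E, Sum.elim_inr, Sym2.eq_iff] at h
      rcases h with ⟨h1, h2⟩ | ⟨h1, h2⟩
      · rw [Subtype.ext h1, f.injective h2]
      · exact absurd ⟨_, h1.symm⟩ w.2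
  have hED : ∀ i, ¬ (E i).IsDiag := by
    rintro (i | ⟨w, k⟩) h
    · exact hd i ((Sym2.isDiag_map f.injective).1 h)
    · simp only [E, Sum.elim_inr, Sym2.mk_isDiag_iff] at h
      exact w.2 ⟨_, h.symm⟩
  have hsub : {Γ : SimpleGraph V | (∀ i, (e i).map f ∈ Γ.edgeSet) ∧
      ∀ w ∉ Set.range f, ∀ S ∈ F, ¬ ∀ i, Γ.Adj w (f i) ↔ i ∈ S} ⊆
      ⋃ g ∈ G, {Γ | ∀ i, E i ∈ Γ.edgeSet ↔ b g i} := by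
    rintro Γ ⟨h1, h2⟩
    simp only [Set.mem_iUnion]
    refine ⟨fun w ↦ {i | Γ.Adj w (f i)}, ?_, ?_⟩
    · simp only [G, Fintype.mem_piFinset, Finset.mem_compl]
      intro w hw
      exact h2 w.1 w.2 _ hw (by simp)
    · rintro (i | ⟨w, k⟩)
      · simp [E, b, h1 i]
      · simp [E, b]
  have hcard : Fintype.card W = Fintype.card V - Fintype.card κ := by
    have := Fintype.card_subtype_compl (fun w ↦ w ∈ Set.range f)
    rw [this]
    congr 1
    exact (Fintype.card_congr (Equiv.ofInjective f f.injective)).symm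
  have hpr : ∀ S : Finset κ, (∏ i, if i ∈ S then (p : ℝ) else 1 - p) =
      (p : ℝ) ^ S.card * (1 - p) ^ (Fintype.card κ - S.card) := by
    intro S
    rw [Finset.prod_ite, Finset.prod_const, Finset.prod_const]
    congr 2
    · simp
    · rw [← Finset.card_compl]; congr 1; ext; simp
  -- The weights of all subsets sum to (p + (1 - p))^|κ| = 1.
  have hsum : ∑ S ∈ Fᶜ, (∏ i, if i ∈ S then (p : ℝ) else 1 - p) =
      1 - F.card * ((p : ℝ) ^ 2 * (1 - p) ^ (Fintype.card κ - 2)) := by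
    have h1 := Fintype.sum_pow_mul_eq_add_pow κ (p : ℝ) (1 - p)
    rw [add_sub_cancel, one_pow, ← Finset.sum_compl_add_sum F] at h1
    have h2 : ∑ S ∈ F, (p : ℝ) ^ S.card * (1 - p) ^ (Fintype.card κ - S.card) =
        F.card * ((p : ℝ) ^ 2 * (1 - p) ^ (Fintype.card κ - 2)) := by
      rw [Finset.sum_congr rfl (fun S hS ↦ by rw [hF S hS]), Finset.sum_const, nsmul_eq_mul]
    simp only [hpr]
    linarith
  calc _ ≤ _ := measureReal_mono hsub (measure_ne_top _ _)
    _ ≤ _ := measureReal_biUnion_finset_le _ _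
    _ ≤ ∑ g ∈ G, (p : ℝ) ^ Fintype.card η * ∏ w, ∏ i, if i ∈ g w then (p : ℝ) else 1 - p := by
      refine Finset.sum_le_sum fun g _ ↦ (binomialRandom_real_cylinder_le p hE hED (b g)).trans ?_
      rw [Fintype.prod_sum_type, Fintype.prod_prod_type]
      simp [b]
    _ = (p : ℝ) ^ Fintype.card η * (1 - F.card * ((p : ℝ) ^ 2 *
        (1 - p) ^ (Fintype.card κ - 2))) ^ (Fintype.card V - Fintype.card κ) := by
      rw [← Finset.mul_sum, ← hsum, ← hcard]
      have := Finset.prod_univ_sum (ι := W) (fun _ ↦ Fᶜ)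
        (fun _ S ↦ (∏ i, if i ∈ S then (p : ℝ) else 1 - p))
      rw [← this, Finset.prod_const, Finset.card_univ]
    _ ≤ _ := by
      refine mul_le_mul_of_nonneg_left (one_sub_pow_le_exp ?_ _) (pow_nonneg p.2.1 _)
      rw [← hsum]
      refine Finset.sum_nonneg fun S _ ↦ Finset.prod_nonneg fun i _ ↦ ?_
      split_ifs
      exacts [p.2.1, one_sub_coe_nonneg p]

lemma card_embedding_le_pow (κ : Type*) [Fintype κ] :
    (Nat.card (κ ↪ V) : ℝ) ≤ (Fintype.card V : ℝ) ^ Fintype.card κ := by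
  classical
  rw [Nat.card_eq_fintype_card, Fintype.card_embedding_eq]
  exact_mod_cast Nat.descFactorial_le_pow _ _

lemma real_exists_embedding_le (μ : Measure (SimpleGraph V)) [IsFiniteMeasure μ] {κ : Type*}
    [Fintype κ] (P : (κ ↪ V) → SimpleGraph V → Prop) {B : ℝ} (hB : 0 ≤ B)
    (h : ∀ f, μ.real {Γ | P f Γ} ≤ B) :
    μ.real {Γ | ∃ f, P f Γ} ≤ (Fintype.card V : ℝ) ^ Fintype.card κ * B := by
  classical
  have : {Γ | ∃ f, P f Γ} = ⋃ f ∈ (Finset.univ : Finset (κ ↪ V)), {Γ | P f Γ} := by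
    ext; simp
  rw [this]
  refine (measureReal_biUnion_finset_le _ _).trans ?_
  refine (Finset.sum_le_sum fun f _ ↦ h f).trans ?_
  rw [Finset.sum_const, nsmul_eq_mul, Finset.card_univ, ← Nat.card_eq_fintype_card]
  exact mul_le_mul_of_nonneg_right (card_embedding_le_pow κ) hB

lemma binomialRandom_real_exists_nonedges_le (p : I) {κ η : Type*} [Fintype κ] [Fintype η]
    {e : η → Sym2 κ} (he : Function.Injective e) (hd : ∀ i, ¬ (e i).IsDiag) :
    (binomialRandom V p).real {Γ | ∃ f : κ ↪ V, ∀ i, (e i).map f ∉ Γ.edgeSet} ≤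
      (Fintype.card V : ℝ) ^ Fintype.card κ * (1 - p : ℝ) ^ Fintype.card η := by
  refine real_exists_embedding_le _ _ (pow_nonneg (one_sub_coe_nonneg p) _) fun f ↦ ?_
  have := binomialRandom_real_cylinder_le p (e := fun i ↦ (e i).map f)
    ((Sym2.map.injective f.injective).comp he)
    (fun i h ↦ hd i ((Sym2.isDiag_map f.injective).1 h)) (fun _ ↦ false)
  simpa using this

/-- The difference of the two sides is (s - t)(s - t - 1)/2, nonnegative for integers. This linear
minorant of the number of pairs lets the sum over common neighbourhoods factorise. -/
lemma mul_le_choose_two_add (s t : ℕ) : t * s ≤ s.choose 2 + (t + 1).choose 2 := by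
  have h2 : s.choose 2 * 2 = s * (s - 1) := by
    rw [Nat.choose_two_right]; exact Nat.div_mul_cancel (Nat.even_mul_pred_self s).two_dvd
  have h3 : (t + 1).choose 2 * 2 = (t + 1) * t := by
    rw [Nat.choose_two_right, Nat.add_sub_cancel]
    exact Nat.div_mul_cancel (by simpa [mul_comm] using (Nat.even_mul_succ_self t).two_dvd)
  rcases s with _ | s
  · simp
  · simp only [Nat.add_sub_cancel] at h2
    zify at *
    rcases le_or_gt (t : ℤ) s with h | h
    · nlinarith [mul_nonneg (sub_nonneg.2 h) (sub_nonneg.2 h)]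
    · nlinarith [mul_nonneg (sub_nonneg.2 h.le) (sub_nonneg.2 (Int.add_one_le_of_lt h))]

/-- The probability that the common neighbourhood of two given vertices is a clique. -/
lemma binomialRandom_real_clique_le (p : I) (t : ℕ) {a b : V} (hab : a ≠ b) :
    (p : ℝ) ^ (t + 1).choose 2 * (binomialRandom V p).real {Γ | ∀ x y, x ≠ y →
      Γ.Adj a x → Γ.Adj b x → Γ.Adj a y → Γ.Adj b y → Γ.Adj x y} ≤
    (1 - (p : ℝ) ^ 2 * (1 - (p : ℝ) ^ t)) ^ (Fintype.card V - 2) := by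
  classical
  let X := {x : V // x ≠ a ∧ x ≠ b}
  -- `g` records the adjacencies to `a` and `b`; `S g` is the resulting common neighbourhood, all of
  -- whose pairs must be edges.
  let S (g : X → Bool × Bool) := {x : X // g x = (true, true)}
  let ι (g : X → Bool × Bool) := ((X ⊕ X) ⊕ {z : Sym2 (S g) // ¬ z.IsDiag})
  let E (g) : ι g → Sym2 V := Sum.elim (Sum.elim (fun x ↦ s(a, x.1)) (fun x ↦ s(b, x.1)))
    (fun z ↦ z.1.map (fun x : S g ↦ x.1.1))
  let B (g) : ι g → Bool := Sum.elim (Sum.elim (fun x ↦ (g x).1) (fun x ↦ (g x).2)) (fun _ ↦ true)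
  let wt : Bool × Bool → ℝ := fun c ↦ (if c.1 then (p : ℝ) else 1 - p) * (if c.2 then (p : ℝ) else 1 - p)
  have hSinj (g) : Function.Injective (fun x : S g ↦ x.1.1) :=
    Subtype.val_injective.comp Subtype.val_injective
  have hE (g) : Function.Injective (E g) := by
    have hne : ∀ z : Sym2 (S g), ∀ y : V, z.map (fun x : S g ↦ x.1.1) ≠ s(a, y) ∧
        z.map (fun x : S g ↦ x.1.1) ≠ s(b, y) := by
      intro z y
      constructor
      · intro h
        have : a ∈ z.map (fun x : S g ↦ x.1.1) := by rw [h]; simp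
        obtain ⟨x, -, hx⟩ := Sym2.mem_map.1 this
        exact x.1.2.1 hx
      · intro h
        have : b ∈ z.map (fun x : S g ↦ x.1.1) := by rw [h]; simp
        obtain ⟨x, -, hx⟩ := Sym2.mem_map.1 this
        exact x.1.2.2 hx
    rintro ((x | x) | z) ((y | y) | z') h
    · simp only [E, Sum.elim_inl, Sym2.eq_iff] at h
      rcases h with ⟨-, h⟩ | ⟨h, -⟩
      · rw [Subtype.ext h]
      · exact absurd h.symm y.2.1
    · simp only [E, Sum.elim_inl, Sum.elim_inr, Sym2.eq_iff] at h
      rcases h with ⟨h, -⟩ | ⟨h, -⟩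
      · exact absurd h hab
      · exact absurd h.symm y.2.1
    · exact absurd h.symm (hne _ _).1
    · simp only [E, Sum.elim_inl, Sum.elim_inr, Sym2.eq_iff] at h
      rcases h with ⟨h, -⟩ | ⟨-, h⟩
      · exact absurd h.symm hab
      · exact absurd h x.2.1
    · simp only [E, Sum.elim_inl, Sum.elim_inr, Sym2.eq_iff] at h
      rcases h with ⟨-, h⟩ | ⟨h, -⟩
      · rw [Subtype.ext h]
      · exact absurd h.symm y.2.2
    · exact absurd h.symm (hne _ _).2
    · exact absurd h (hne _ _).1
    · exact absurd h (hne _ _).2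
    · simp only [E, Sum.elim_inr] at h
      rw [Subtype.ext (Sym2.map.injective (hSinj g) h)]
  have hED (g) : ∀ i, ¬ (E g i).IsDiag := by
    rintro ((x | x) | z) h
    · exact x.2.1 (by simpa [E, eq_comm] using h)
    · exact x.2.2 (by simpa [E, eq_comm] using h)
    · exact z.2 ((Sym2.isDiag_map (hSinj g)).1 h)
  have hsub : {Γ : SimpleGraph V | ∀ x y, x ≠ y →
      Γ.Adj a x → Γ.Adj b x → Γ.Adj a y → Γ.Adj b y → Γ.Adj x y} ⊆
      ⋃ g ∈ (Finset.univ : Finset (X → Bool × Bool)), {Γ | ∀ i, E g i ∈ Γ.edgeSet ↔ B g i} := by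
    intro Γ h
    simp only [Set.mem_iUnion]
    refine ⟨fun x ↦ (decide (Γ.Adj a x), decide (Γ.Adj b x)), Finset.mem_univ _, ?_⟩
    rintro ((x | x) | ⟨z, hz⟩)
    · simp [E, B]
    · simp [E, B]
    · induction z with
      | h x y =>
        have hx := x.2
        have hy := y.2
        simp only [Prod.mk.injEq, decide_eq_true_eq] at hx hy
        simp only [E, B, Sum.elim_inr, Sym2.map_mk, mem_edgeSet, iff_true]
        refine h _ _ (fun hxy ↦ hz ?_) hx.1 hx.2 hy.1 hy.2
        exact Sym2.mk_isDiag_iff.2 (hSinj _ hxy)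
  have hcard : Fintype.card X = Fintype.card V - 2 := by
    have h1 := Fintype.card_subtype_compl (fun w ↦ w = a ∨ w = b)
    have h2 : Fintype.card {w // w = a ∨ w = b} = 2 := by
      rw [Fintype.card_subtype, ← Finset.card_pair hab]
      congr 1; ext; simp
    rw [h2] at h1
    rw [← h1]
    exact Fintype.card_congr (Equiv.subtypeEquivRight (by simp))
  have hwt : ∀ c, 0 ≤ wt c := by
    intro c
    have := one_sub_coe_nonneg p
    have := p.2.1
    simp only [wt]; split_ifs <;> positivity
  have hbound (g : X → Bool × Bool) : (p : ℝ) ^ (t + 1).choose 2 *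
      (binomialRandom V p).real {Γ | ∀ i, E g i ∈ Γ.edgeSet ↔ B g i} ≤
      ∏ x, (wt (g x) * if g x = (true, true) then (p : ℝ) ^ t else 1) := by
    have h1 := binomialRandom_real_cylinder_le p (hE g) (hED g) (B g)
    have h2 : (∏ i, if B g i then (p : ℝ) else 1 - p) =
        (∏ x, wt (g x)) * (p : ℝ) ^ (Fintype.card (S g)).choose 2 := by
      rw [Fintype.prod_sum_type, Fintype.prod_sum_type, ← Finset.prod_mul_distrib]
      congr 1
      simp only [B, Sum.elim_inr, if_true, Finset.prod_const, Finset.card_univ]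
      rw [Sym2.card_subtype_not_diag]
    have h3 : (∏ x, if g x = (true, true) then (p : ℝ) ^ t else 1) =
        (p : ℝ) ^ (t * Fintype.card (S g)) := by
      rw [Finset.prod_ite, Finset.prod_const, Finset.prod_const_one, mul_one, ← pow_mul,
        Fintype.card_subtype]
    rw [Finset.prod_mul_distrib, h3]
    calc _ ≤ _ := mul_le_mul_of_nonneg_left (h1.trans h2.le) (pow_nonneg p.2.1 _)
      _ = (∏ x, wt (g x)) * (p : ℝ) ^ ((Fintype.card (S g)).choose 2 + (t + 1).choose 2) := by
        rw [pow_add]; ring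
      _ ≤ _ := mul_le_mul_of_nonneg_left
        (pow_le_pow_of_le_one p.2.1 p.2.2 (mul_le_choose_two_add _ _))
        (Finset.prod_nonneg fun _ _ ↦ hwt _)
  calc _ ≤ _ := mul_le_mul_of_nonneg_left ((measureReal_mono hsub (measure_ne_top _ _)).trans
          (measureReal_biUnion_finset_le _ _)) (pow_nonneg p.2.1 _)
    _ ≤ ∑ g : X → Bool × Bool, ∏ x, (wt (g x) * if g x = (true, true) then (p : ℝ) ^ t else 1) := by
      rw [Finset.mul_sum]
      exact Finset.sum_le_sum fun g _ ↦ hbound g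
    _ = _ := by
      have := Finset.prod_univ_sum (ι := X) (fun _ ↦ (Finset.univ : Finset (Bool × Bool)))
        (fun _ c ↦ (wt c * if c = (true, true) then (p : ℝ) ^ t else 1))
      rw [Fintype.piFinset_univ] at this
      rw [← this, Finset.prod_const, Finset.card_univ, hcard]
      -- Each vertex contributes p² p^t + (1 - p²).
      congr 1
      simp [Fintype.sum_prod_type, wt]
      ring

lemma binomialRandom_real_exists_clique_le (p : I) (t : ℕ) :
    (p : ℝ) ^ (t + 1).choose 2 * (binomialRandom V p).real {Γ | ∃ a b, a ≠ b ∧ ∀ x y, x ≠ y →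
      Γ.Adj a x → Γ.Adj b x → Γ.Adj a y → Γ.Adj b y → Γ.Adj x y} ≤
    (Fintype.card V : ℝ) ^ 2 *
      Real.exp (-((p : ℝ) ^ 2 * (1 - (p : ℝ) ^ t) * (Fintype.card V - 2 : ℕ))) := by
  classical
  have hp0 := p.2.1
  have hp1 := p.2.2
  have hr : 0 ≤ 1 - (p : ℝ) ^ 2 * (1 - (p : ℝ) ^ t) := by
    have h1 : (p : ℝ) ^ 2 ≤ 1 := pow_le_one₀ hp0 hp1
    have h2 : (p : ℝ) ^ t ≤ 1 := pow_le_one₀ hp0 hp1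
    have h3 : 0 ≤ (p : ℝ) ^ t := pow_nonneg hp0 _
    nlinarith [sq_nonneg (p : ℝ)]
  have hsub : {Γ : SimpleGraph V | ∃ a b, a ≠ b ∧ ∀ x y, x ≠ y →
      Γ.Adj a x → Γ.Adj b x → Γ.Adj a y → Γ.Adj b y → Γ.Adj x y} ⊆
      ⋃ z ∈ (Finset.univ : Finset (V × V)).filter (fun z ↦ z.1 ≠ z.2), {Γ | ∀ x y, x ≠ y →
      Γ.Adj z.1 x → Γ.Adj z.2 x → Γ.Adj z.1 y → Γ.Adj z.2 y → Γ.Adj x y} := by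
    rintro Γ ⟨a, b, hab, h⟩
    simp only [Set.mem_iUnion]
    exact ⟨(a, b), by simpa using hab, h⟩
  calc _ ≤ _ := mul_le_mul_of_nonneg_left ((measureReal_mono hsub (measure_ne_top _ _)).trans
          (measureReal_biUnion_finset_le _ _)) (pow_nonneg hp0 _)
    _ ≤ ∑ z ∈ (Finset.univ : Finset (V × V)).filter (fun z ↦ z.1 ≠ z.2),
        (1 - (p : ℝ) ^ 2 * (1 - (p : ℝ) ^ t)) ^ (Fintype.card V - 2) := by
      rw [Finset.mul_sum]
      exact Finset.sum_le_sum fun z hz ↦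
        binomialRandom_real_clique_le p t (Finset.mem_filter.1 hz).2
    _ ≤ _ := by
      rw [Finset.sum_const, nsmul_eq_mul]
      refine mul_le_mul ?_ (one_sub_pow_le_exp hr _) (pow_nonneg hr _) (sq_nonneg _)
      have := Finset.card_filter_le (Finset.univ : Finset (V × V)) (fun z ↦ z.1 ≠ z.2)
      rw [Finset.card_univ, Fintype.card_prod, ← sq] at this
      exact_mod_cast this

end Probability

/-! ### From Morse cycles to cycles with clique common neighbourhoods -/

section Deterministic

variable {V : Type*} {G : SimpleGraph V}

lemma zmod_natCast_ne_zero {k m : ℕ} (hm : m ≠ 0) (hk : m < k) : (m : ZMod k) ≠ 0 := by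
  rw [Ne, ZMod.natCast_eq_zero_iff]
  exact fun h ↦ absurd (Nat.le_of_dvd (Nat.pos_of_ne_zero hm) h) (not_le.2 hk)

/-- The four vertices of an induced square span an induced `4`-cycle. -/
lemma induce_square_isKCycle {a b c d : V} (hac : a ≠ c) (hbd : b ≠ d) (hab : G.Adj a b)
    (hbc : G.Adj b c) (hcd : G.Adj c d) (hda : G.Adj d a) (nac : ¬ G.Adj a c)
    (nbd : ¬ G.Adj b d) :
    ((⊤ : G.Subgraph).induce {a, b, c, d}).IsKCycle 4 := by
  refine ⟨by norm_num, ⟨RelIso.symm ?_⟩⟩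
  let f : Fin 4 → V := ![a, b, c, d]
  have hf : Function.Injective f := by
    have := hab.ne; have := hbc.ne; have := hcd.ne; have := hda.ne
    intro i j h
    fin_cases i <;> fin_cases j <;> simp_all [f]
  have hr : ∀ x, x ∈ ((⊤ : G.Subgraph).induce {a, b, c, d}).verts ↔ x ∈ Set.range f := by
    intro x
    simp only [f, Subgraph.induce_verts, Set.mem_insert_iff, Set.mem_singleton_iff, Set.mem_range,
      Fin.exists_fin_succ, eq_comm (a := x)]
    simp
  refine ⟨(Equiv.ofInjective f hf).trans (Equiv.subtypeEquivRight fun x ↦ (hr x).symm), ?_⟩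
  intro i j
  have key : G.Adj (f i) (f j) ↔ (cycleGraph 4).Adj i j := by
    have := hab.symm; have := hbc.symm; have := hcd.symm; have := hda.symm
    have : ¬ G.Adj c a := fun h ↦ nac h.symm
    have : ¬ G.Adj d b := fun h ↦ nbd h.symm
    fin_cases i <;> fin_cases j <;> simp_all [f] <;> decide
  rw [← key]
  have h1 := (hr (f i)).2 ⟨i, rfl⟩
  have h2 := (hr (f j)).2 ⟨j, rfl⟩
  simp only [Subgraph.coe_adj, Subgraph.induce_adj, Subgraph.top_adj]
  exact ⟨fun h ↦ h.2.2, fun h ↦ ⟨h1, h2, h⟩⟩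

/-- A map `v` presenting an induced `k`-cycle all of whose pairs of non-adjacent vertices have a
clique as common neighbourhood. -/
structure IsCliqueLinkedCycle (G : SimpleGraph V) (k : ℕ) (v : ZMod k → V) : Prop where
  injective : Function.Injective v
  adj_iff : ∀ i j, G.Adj (v i) (v j) ↔ i - j = 1 ∨ j - i = 1
  adj_of_common : ∀ i j, i ≠ j → ¬ G.Adj (v i) (v j) → ∀ x y, x ≠ y →
    G.Adj (v i) x → G.Adj (v j) x → G.Adj (v i) y → G.Adj (v j) y → G.Adj x y

/-- The cycle graph on at least five vertices has no four-cycle. -/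
lemma zmod_not_four_cycle {k : ℕ} (hk : 5 ≤ k) {a b c d : ZMod k} (hac : a ≠ c) (hbd : b ≠ d)
    (hab : a - b = 1 ∨ b - a = 1) (hbc : b - c = 1 ∨ c - b = 1) (hcd : c - d = 1 ∨ d - c = 1)
    (hda : d - a = 1 ∨ a - d = 1) : False := by
  have h4 : (4 : ZMod k) ≠ 0 := by
    exact_mod_cast zmod_natCast_ne_zero (k := k) (m := 4) (by norm_num) (by omega)
  -- Going round takes four steps ±1. Consecutive opposite signs identify two opposite vertices;
  -- four equal signs give 4 = 0.
  rcases hab with hab | hab <;> rcases hbc with hbc | hbc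
  · rcases hcd with hcd | hcd
    · rcases hda with hda | hda
      · exact h4 (by linear_combination -hab - hbc - hcd - hda)
      · exact hbd (by linear_combination hda - hab)
    · exact hbd (by linear_combination hbc - hcd)
  · exact hac (by linear_combination hab - hbc)
  · exact hac (by linear_combination hbc - hab)
  · rcases hcd with hcd | hcd
    · exact hbd (by linear_combination hcd - hbc)
    · rcases hda with hda | hda
      · exact hbd (by linear_combination hab - hda)
      · exact h4 (by linear_combination -hab - hbc - hcd - hda)

lemma exists_isCliqueLinkedCycle {k : ℕ} (hk : 5 ≤ k) {Λ : G.Subgraph} (h : Λ.IsMorseCycle k) :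
    ∃ v : ZMod k → V, IsCliqueLinkedCycle G k v := by
  obtain ⟨⟨-, ⟨φ⟩⟩, hind, hM⟩ := h
  -- In successor form `ZMod` unfolds to `Fin`, the vertex type of `cycleGraph`.
  obtain ⟨k, rfl⟩ : ∃ l, k = l + 1 := ⟨k - 1, by omega⟩
  let v : ZMod (k + 1) → V := fun i ↦ (φ.symm i : V)
  have hv : Function.Injective v := Subtype.val_injective.comp φ.symm.injective
  have hmem : ∀ x ∈ Λ.verts, ∃ i, v i = x := fun x hx ↦
    ⟨φ ⟨x, hx⟩, by simp [v]⟩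
  have hadj : ∀ i j, G.Adj (v i) (v j) ↔ i - j = 1 ∨ j - i = 1 := by
    intro i j
    have h1 : G.Adj (v i) (v j) ↔ Λ.coe.Adj (φ.symm i) (φ.symm j) :=
      ⟨fun h ↦ hind (φ.symm i).2 (φ.symm j).2 h, fun h ↦ Λ.adj_sub h⟩
    have hcyc : ∀ i j : Fin (k + 1), (cycleGraph (k + 1)).Adj i j ↔
        i ≠ j ∧ (i - j = 1 ∨ j - i = 1) := by
      intro i j
      rw [cycleGraph_eq_circulantGraph, circulantGraph_adj]
      simp only [Set.mem_singleton_iff]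
    refine h1.trans (φ.symm.map_rel_iff.trans ((hcyc i j).trans ?_))
    change i ≠ j ∧ (i - j = 1 ∨ j - i = 1) ↔ i - j = 1 ∨ j - i = 1
    refine ⟨fun h ↦ h.2, fun h ↦ ⟨?_, h⟩⟩
    rintro rfl
    have h1 : (1 : ZMod (k + 1)) ≠ 0 := by
      exact_mod_cast zmod_natCast_ne_zero (k := k + 1) (m := 1) (by norm_num) (by omega)
    exact h1 (by simpa [eq_comm] using h)
  refine ⟨v, hv, hadj, fun i j hij nij x y hxy ix jx iy jy ↦ ?_⟩
  by_contra nxy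
  have hle := hM ((⊤ : G.Subgraph).induce {v i, x, v j, y})
    (by
      intro a ha b hb hab
      exact ⟨ha, hb, hab⟩)
    (induce_square_isKCycle (hv.ne hij) hxy ix jx.symm jy iy.symm nij nxy)
    ⟨v i, ⟨by simp, (φ.symm i).2⟩, v j, ⟨by simp, (φ.symm j).2⟩, hv.ne hij, nij⟩
  obtain ⟨s, rfl⟩ := hmem x (hle.1 (by simp))
  obtain ⟨t, rfl⟩ := hmem y (hle.1 (by simp))
  rw [hadj] at ix jx iy jy
  exact zmod_not_four_cycle hk hij (fun h ↦ hxy (congrArg v h)) ix jx.symm jy iy.symm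

namespace IsCliqueLinkedCycle

variable {k : ℕ} {v : ZMod k → V}

lemma adj_add_one (h : IsCliqueLinkedCycle G k v) (i : ZMod k) : G.Adj (v i) (v (i + 1)) :=
  (h.adj_iff _ _).2 (Or.inr (by ring))

lemma not_adj_add (h : IsCliqueLinkedCycle G k v) (i : ZMod k) {m : ℕ} (hm : 2 ≤ m)
    (hk : m + 2 ≤ k) : i ≠ i + m ∧ ¬ G.Adj (v i) (v (i + m)) := by
  refine ⟨fun he ↦ ?_, fun hadj ↦ ?_⟩
  · refine zmod_natCast_ne_zero (k := k) (m := m) (by omega) (by omega) ?_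
    linear_combination -he
  · rcases (h.adj_iff _ _).1 hadj with h | h
    · refine zmod_natCast_ne_zero (k := k) (m := m + 1) (by omega) (by omega) ?_
      push_cast
      linear_combination -h
    · refine zmod_natCast_ne_zero (k := k) (m := m - 1) (by omega) (by omega) ?_
      rw [Nat.cast_sub (by omega)]
      push_cast
      linear_combination h

/-- No vertex is adjacent to `v i` and `v (i + 2)` but not to `v (i + 1)`, unless it is
`v (i + 1)` itself. -/
lemma adj_middle (h : IsCliqueLinkedCycle G k v) (hk : 5 ≤ k) (i : ZMod k) {w : V}
    (hw : w ≠ v (i + 1)) (h1 : G.Adj w (v i)) (h2 : G.Adj w (v (i + 2))) :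
    G.Adj w (v (i + 1)) := by
  have h3 := h.not_adj_add i (m := 2) le_rfl (by omega)
  push_cast at h3
  refine h.adj_of_common i (i + 2) h3.1 h3.2 w _ hw h1.symm h2.symm (h.adj_add_one i) ?_
  have := (h.adj_add_one (i + 1)).symm
  rwa [add_assoc, one_add_one_eq_two] at this

lemma exists_clique (h : IsCliqueLinkedCycle G k v) (hk : 5 ≤ k) :
    ∃ a b, a ≠ b ∧ ∀ x y, x ≠ y → G.Adj a x → G.Adj b x → G.Adj a y → G.Adj b y → G.Adj x y := by
  have h3 := h.not_adj_add 0 (m := 2) le_rfl (by omega)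
  exact ⟨_, _, h.injective.ne h3.1, h.adj_of_common _ _ h3.1 h3.2⟩

lemma injective_natCast (h : IsCliqueLinkedCycle G k v) {m : ℕ} (hm : m ≤ k) :
    Function.Injective (fun i : Fin m ↦ v (i : ℕ)) := by
  intro i j hij
  have h1 := (ZMod.natCast_eq_natCast_iff' _ _ _).1 (h.injective hij)
  rw [Nat.mod_eq_of_lt (by omega), Nat.mod_eq_of_lt (by omega)] at h1
  exact Fin.ext h1

/-- Among five consecutive vertices the pairs at distance 2 or 3 are never adjacent. The pair {0, 4}
is left out because it is an edge when k = 5. -/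
lemma exists_nonedges (h : IsCliqueLinkedCycle G k v) (hk : 5 ≤ k) :
    ∃ f : Fin 5 ↪ V, ∀ i : Fin 5,
      ((![s(0, 2), s(0, 3), s(1, 3), s(1, 4), s(2, 4)] : Fin 5 → Sym2 (Fin 5)) i).map f ∉
        G.edgeSet := by
  refine ⟨⟨_, h.injective_natCast hk⟩, fun i ↦ ?_⟩
  have h0 (m : ℕ) (j : ZMod k) (hj : j = m + (2 : ℕ)) : ¬ G.Adj (v m) (v j) := by
    subst hj; exact (h.not_adj_add (m : ZMod k) (m := 2) le_rfl (by omega)).2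
  have h1 (m : ℕ) (j : ZMod k) (hj : j = m + (3 : ℕ)) : ¬ G.Adj (v m) (v j) := by
    subst hj; exact (h.not_adj_add (m : ZMod k) (m := 3) (by omega) (by omega)).2
  fin_cases i
  · exact h0 0 _ (by norm_num)
  · exact h1 0 _ (by norm_num)
  · exact h0 1 _ (by norm_num)
  · exact h1 1 _ (by norm_num)
  · exact h0 2 _ (by norm_num)

lemma exists_cycle_pattern (h : IsCliqueLinkedCycle G k v) (hk : 5 ≤ k) [NeZero k] :
    ∃ f : ZMod k ↪ V, (∀ i : ZMod k, s(i, i + 1).map f ∈ G.edgeSet) ∧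
      ∀ w ∉ Set.range f, ∀ S ∈ Finset.univ.image (fun i : ZMod k ↦ ({i, i + 2} : Finset (ZMod k))),
        ¬ ∀ i, G.Adj w (f i) ↔ i ∈ S := by
  refine ⟨⟨v, h.injective⟩, h.adj_add_one, ?_⟩
  intro w hw S hS hadj
  obtain ⟨i, -, rfl⟩ := Finset.mem_image.1 hS
  have h1 := h.adj_middle hk i (w := w) (fun he ↦ hw ⟨_, he.symm⟩)
    ((hadj i).2 (by simp)) ((hadj (i + 2)).2 (by simp))
  have h2 := (hadj (i + 1)).1 h1
  have h3 : (1 : ZMod k) ≠ 0 := by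
    exact_mod_cast zmod_natCast_ne_zero (k := k) (m := 1) (by norm_num) (by omega)
  simp only [Finset.mem_insert, Finset.mem_singleton] at h2
  rcases h2 with h2 | h2
  · exact h3 (by linear_combination h2)
  · exact h3 (by linear_combination -h2)

/-- An initial segment of the cycle has `r` interior vertices, each giving a forbidden pair,
whatever the value of `k`. One pattern thus serves all long cycles. -/
lemma exists_path_pattern (h : IsCliqueLinkedCycle G k v) (hk : 5 ≤ k) {r : ℕ} (hr : r + 2 ≤ k) :
    ∃ f : Fin (r + 2) ↪ V, (∀ i : Fin (r + 1), s(i.castSucc, i.succ).map f ∈ G.edgeSet) ∧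
      ∀ w ∉ Set.range f, ∀ S ∈ Finset.univ.image
        (fun i : Fin r ↦ ({i.castSucc.castSucc, i.succ.succ} : Finset (Fin (r + 2)))),
        ¬ ∀ i, G.Adj w (f i) ↔ i ∈ S := by
  refine ⟨⟨_, h.injective_natCast hr⟩, fun i ↦ ?_, ?_⟩
  · have := h.adj_add_one (i : ℕ)
    simpa using this
  intro w hw S hS hadj
  obtain ⟨i, -, rfl⟩ := Finset.mem_image.1 hS
  have h1 := h.adj_middle hk (i : ℕ) (w := w)
    (fun he ↦ hw ⟨i.castSucc.succ, by simpa using he.symm⟩)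
    (by simpa using (hadj i.castSucc.castSucc).2 (by simp))
    (by simpa [add_assoc, one_add_one_eq_two] using (hadj i.succ.succ).2 (by simp))
  have h2 := (hadj i.castSucc.succ).1 (by simpa using h1)
  simp [Fin.ext_iff] at h2

end IsCliqueLinkedCycle

end Deterministic

/-- `G` has an induced cycle of length at least five all of whose pairs of non-adjacent vertices
have a clique as common neighbourhood. -/
def HasCliqueLinkedCycle {V : Type*} (G : SimpleGraph V) : Prop :=
  ∃ k, 5 ≤ k ∧ ∃ v : ZMod k → V, IsCliqueLinkedCycle G k v

/-! ### First moment bounds for a fixed number of vertices -/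

section FirstMoment

variable {V : Type*} [Fintype V] (p : I)

lemma real_hasCliqueLinkedCycle_le_nonedges :
    (binomialRandom V p).real {Γ | Γ.HasCliqueLinkedCycle} ≤
      (Fintype.card V : ℝ) ^ 5 * (1 - p : ℝ) ^ 5 := by
  have h := binomialRandom_real_exists_nonedges_le (V := V) p
    (e := (![s(0, 2), s(0, 3), s(1, 3), s(1, 4), s(2, 4)] : Fin 5 → Sym2 (Fin 5)))
    (by decide) (by decide)
  simp only [Fintype.card_fin] at h
  refine (measureReal_mono ?_ (measure_ne_top _ _)).trans h
  rintro Γ ⟨k, hk, v, hv⟩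
  exact hv.exists_nonedges hk

lemma real_hasCliqueLinkedCycle_le_clique (t : ℕ) :
    (p : ℝ) ^ (t + 1).choose 2 * (binomialRandom V p).real {Γ | Γ.HasCliqueLinkedCycle} ≤
      (Fintype.card V : ℝ) ^ 2 *
        Real.exp (-((p : ℝ) ^ 2 * (1 - (p : ℝ) ^ t) * (Fintype.card V - 2 : ℕ))) := by
  refine le_trans ?_ (binomialRandom_real_exists_clique_le p t)
  refine mul_le_mul_of_nonneg_left (measureReal_mono ?_ (measure_ne_top _ _)) (pow_nonneg p.2.1 _)
  rintro Γ ⟨k, hk, v, hv⟩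
  exact hv.exists_clique hk

lemma real_exists_cycle_pattern_le {k : ℕ} (hk : 5 ≤ k) [NeZero k] :
    (binomialRandom V p).real {Γ | ∃ f : ZMod k ↪ V, (∀ i : ZMod k, s(i, i + 1).map f ∈ Γ.edgeSet) ∧
      ∀ w ∉ Set.range f, ∀ S ∈ Finset.univ.image (fun i : ZMod k ↦ ({i, i + 2} : Finset (ZMod k))),
        ¬ ∀ i, Γ.Adj w (f i) ↔ i ∈ S} ≤
      (Fintype.card V : ℝ) ^ k * ((p : ℝ) ^ k *
        Real.exp (-(k * ((p : ℝ) ^ 2 * (1 - p) ^ (k - 2)) * (Fintype.card V - k : ℕ)))) := by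
  -- 1 ≠ 0 excludes loops, 2 ≠ 0 makes the edges distinct and the sets {i, i + 2} genuine pairs, and
  -- 4 ≠ 0 makes these pairs distinct.
  have h1 : (1 : ZMod k) ≠ 0 := by
    exact_mod_cast zmod_natCast_ne_zero (k := k) (m := 1) (by norm_num) (by omega)
  have h2 : (2 : ZMod k) ≠ 0 := by
    exact_mod_cast zmod_natCast_ne_zero (k := k) (m := 2) (by norm_num) (by omega)
  have h4 : (4 : ZMod k) ≠ 0 := by
    exact_mod_cast zmod_natCast_ne_zero (k := k) (m := 4) (by norm_num) (by omega)
  have hinj : Function.Injective (fun i : ZMod k ↦ ({i, i + 2} : Finset (ZMod k))) := by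
    intro i j hij
    have hi : i ∈ ({j, j + 2} : Finset (ZMod k)) := by
      rw [← show ({i, i + 2} : Finset (ZMod k)) = {j, j + 2} from hij]; simp
    have hj : j ∈ ({i, i + 2} : Finset (ZMod k)) := by
      rw [show ({i, i + 2} : Finset (ZMod k)) = {j, j + 2} from hij]; simp
    simp only [Finset.mem_insert, Finset.mem_singleton] at hi hj
    rcases hi with hi | hi
    · exact hi
    rcases hj with hj | hj
    · exact hj.symm
    · exact absurd (by linear_combination -hi - hj) h4
  have hB := fun f : ZMod k ↪ V ↦ binomialRandom_real_pattern_le p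
    (e := fun i : ZMod k ↦ s(i, i + 1)) (by
      intro i j hij
      rcases Sym2.eq_iff.1 hij with ⟨h, -⟩ | ⟨h, h'⟩
      · exact h
      · exact absurd (by linear_combination h' - h) h2) (by
      intro i hi
      rw [Sym2.mk_isDiag_iff] at hi
      exact h1 (by linear_combination -hi))
    (Finset.univ.image (fun i : ZMod k ↦ ({i, i + 2} : Finset (ZMod k)))) (by
      intro S hS
      obtain ⟨i, -, rfl⟩ := Finset.mem_image.1 hS
      exact Finset.card_pair (fun h ↦ h2 (by linear_combination -h))) f
  rw [Finset.card_image_of_injective _ hinj, Finset.card_univ, ZMod.card] at hB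
  have := real_exists_embedding_le (binomialRandom V p) _
    (mul_nonneg (pow_nonneg p.2.1 _) (Real.exp_nonneg _)) hB
  rwa [ZMod.card] at this

lemma real_exists_path_pattern_le (r : ℕ) :
    (binomialRandom V p).real {Γ | ∃ f : Fin (r + 2) ↪ V,
      (∀ i : Fin (r + 1), s(i.castSucc, i.succ).map f ∈ Γ.edgeSet) ∧
      ∀ w ∉ Set.range f, ∀ S ∈ Finset.univ.image
        (fun i : Fin r ↦ ({i.castSucc.castSucc, i.succ.succ} : Finset (Fin (r + 2)))),
        ¬ ∀ i, Γ.Adj w (f i) ↔ i ∈ S} ≤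
      (Fintype.card V : ℝ) ^ (r + 2) * ((p : ℝ) ^ (r + 1) *
        Real.exp (-(r * ((p : ℝ) ^ 2 * (1 - p) ^ r) * (Fintype.card V - (r + 2) : ℕ)))) := by
  have hinj : Function.Injective
      (fun i : Fin r ↦ ({i.castSucc.castSucc, i.succ.succ} : Finset (Fin (r + 2)))) := by
    intro i j hij
    have hi : i.castSucc.castSucc ∈
        ({j.castSucc.castSucc, j.succ.succ} : Finset (Fin (r + 2))) := by
      rw [← show ({i.castSucc.castSucc, i.succ.succ} : Finset (Fin (r + 2))) =
        {j.castSucc.castSucc, j.succ.succ} from hij]; simp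
    have hj : j.castSucc.castSucc ∈
        ({i.castSucc.castSucc, i.succ.succ} : Finset (Fin (r + 2))) := by
      rw [show ({i.castSucc.castSucc, i.succ.succ} : Finset (Fin (r + 2))) =
        {j.castSucc.castSucc, j.succ.succ} from hij]; simp
    simp only [Finset.mem_insert, Finset.mem_singleton, Fin.ext_iff, Fin.val_castSucc,
      Fin.val_succ] at hi hj ⊢
    omega
  have hB := fun f : Fin (r + 2) ↪ V ↦ binomialRandom_real_pattern_le p
    (e := fun i : Fin (r + 1) ↦ s(i.castSucc, i.succ)) (by
      intro i j hij
      have := Sym2.eq_iff.1 hij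
      simp only [Fin.ext_iff, Fin.val_castSucc, Fin.val_succ] at this ⊢
      omega) (by
      intro i hi
      rw [Sym2.mk_isDiag_iff] at hi
      simp [Fin.ext_iff] at hi)
    (Finset.univ.image
      (fun i : Fin r ↦ ({i.castSucc.castSucc, i.succ.succ} : Finset (Fin (r + 2))))) (by
      intro S hS
      obtain ⟨i, -, rfl⟩ := Finset.mem_image.1 hS
      exact Finset.card_pair (by simp only [ne_eq, Fin.ext_iff, Fin.val_castSucc, Fin.val_succ]; omega)) f
  rw [Finset.card_image_of_injective _ hinj, Finset.card_univ] at hB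
  simp only [Fintype.card_fin] at hB
  have := real_exists_embedding_le (binomialRandom V p) _
    (mul_nonneg (pow_nonneg p.2.1 _) (Real.exp_nonneg _)) hB
  rwa [Fintype.card_fin] at this

lemma real_hasCliqueLinkedCycle_le_sparse (r : ℕ) :
    (binomialRandom V p).real {Γ | Γ.HasCliqueLinkedCycle} ≤
      ∑ k ∈ Finset.Ico 5 (r + 2), (Fintype.card V : ℝ) ^ k * ((p : ℝ) ^ k *
        Real.exp (-(k * ((p : ℝ) ^ 2 * (1 - p) ^ (k - 2)) * (Fintype.card V - k : ℕ)))) +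
      (Fintype.card V : ℝ) ^ (r + 2) * ((p : ℝ) ^ (r + 1) *
        Real.exp (-(r * ((p : ℝ) ^ 2 * (1 - p) ^ r) * (Fintype.card V - (r + 2) : ℕ)))) := by
  let A (k : ℕ) : Set (SimpleGraph V) := {Γ | 5 ≤ k ∧ ∃ v : ZMod k → V, IsCliqueLinkedCycle Γ k v}
  have hsub : {Γ : SimpleGraph V | Γ.HasCliqueLinkedCycle} ⊆
      (⋃ k ∈ Finset.Ico 5 (r + 2), A k) ∪ ⋃ k ∈ {k | r + 2 ≤ k}, A k := by
    rintro Γ ⟨k, hk, v⟩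
    rcases lt_or_ge k (r + 2) with h | h
    · exact Or.inl (Set.mem_biUnion (Finset.mem_Ico.2 ⟨hk, h⟩) ⟨hk, v⟩)
    · exact Or.inr (Set.mem_biUnion (x := k) h ⟨hk, v⟩)
  refine (measureReal_mono hsub (measure_ne_top _ _)).trans
    ((measureReal_union_le _ _).trans (add_le_add ?_ ?_))
  · refine (measureReal_biUnion_finset_le _ _).trans (Finset.sum_le_sum fun k hk ↦ ?_)
    have hk5 := (Finset.mem_Ico.1 hk).1
    have : NeZero k := ⟨by omega⟩
    refine (measureReal_mono ?_ (measure_ne_top _ _)).trans (real_exists_cycle_pattern_le p hk5)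
    rintro Γ ⟨-, v, hv⟩
    exact hv.exists_cycle_pattern hk5
  · refine (measureReal_mono ?_ (measure_ne_top _ _)).trans (real_exists_path_pattern_le p r)
    intro Γ hΓ
    simp only [Set.mem_iUnion] at hΓ
    obtain ⟨k, hk, hk5, v, hv⟩ := hΓ
    exact hv.exists_path_pattern hk5 hk

end FirstMoment

/-! ### Asymptotics in the four ranges of the edge probability -/

section Asymptotics

/-- With q = 1 - p, the bound n⁵q⁵ is at most q, which tends to 0 because q⁴ ≤ n⁻⁵. -/
lemma eventually_hasCliqueLinkedCycle_le_of_few_nonedges {δ : ℝ} (hδ : 0 < δ) :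
    ∀ᶠ n : ℕ in atTop, ∀ p : I, (n : ℝ) ^ 5 * (1 - p : ℝ) ^ 4 ≤ 1 →
      (binomialRandom (Fin n) p).real {Γ | Γ.HasCliqueLinkedCycle} ≤ δ := by
  have h1 : ∀ᶠ n : ℕ in atTop, 1 / (n : ℝ) ≤ δ ^ 4 :=
    tendsto_one_div_atTop_nhds_zero_nat.eventually_le_const (by positivity)
  filter_upwards [h1, eventually_ge_atTop 1] with n hn hn1 p hp
  have hq := one_sub_coe_nonneg p
  have hn1' : (1 : ℝ) ≤ n := by exact_mod_cast hn1
  have h2 := real_hasCliqueLinkedCycle_le_nonedges (V := Fin n) p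
  rw [Fintype.card_fin] at h2
  have h3 : (1 - p : ℝ) ^ 4 ≤ δ ^ 4 := by
    refine le_trans ?_ hn
    rw [le_div_iff₀ (by positivity)]
    calc (1 - p : ℝ) ^ 4 * n ≤ (1 - p : ℝ) ^ 4 * (n : ℝ) ^ 5 :=
          mul_le_mul_of_nonneg_left (le_self_pow₀ hn1' (by norm_num)) (by positivity)
      _ ≤ 1 := by rwa [mul_comm]
  have h4 : (1 - p : ℝ) ≤ δ := le_of_pow_le_pow_left₀ (by norm_num) hδ.le h3
  calc _ ≤ _ := h2
    _ = ((n : ℝ) ^ 5 * (1 - p : ℝ) ^ 4) * (1 - p) := by ring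
    _ ≤ 1 * (1 - p) := mul_le_mul_of_nonneg_right hp hq
    _ ≤ δ := by linarith

/-- For an edge probability `p = 1 - q` in `[1/2, 1)` the choice `t ≈ √n / 10` makes the
clique bound exponentially small in `s / 640`, where `s = n ^ (1 / 4)`. -/
lemma real_hasCliqueLinkedCycle_le_of_dense {n : ℕ} (hn : 400 ≤ n) {s : ℝ} (hs : 0 ≤ s)
    (hsn : s ^ 4 = n) (p : I) (hp : (1 / 2 : ℝ) ≤ p) (hq : 1 < (n : ℝ) ^ 5 * (1 - p : ℝ) ^ 4) :
    (binomialRandom (Fin n) p).real {Γ | Γ.HasCliqueLinkedCycle} ≤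
      s ^ 8 * Real.exp (-(s / 640)) := by
  have hnR : (400 : ℝ) ≤ n := by exact_mod_cast hn
  have hs2 : 20 ≤ s ^ 2 := by
    refine le_of_pow_le_pow_left₀ two_ne_zero (by positivity) ?_
    rw [← pow_mul, hsn]
    linarith
  obtain ⟨t, ht1, ht2⟩ : ∃ t : ℕ, s ^ 2 / 20 ≤ t ∧ (t : ℝ) ≤ s ^ 2 / 10 := by
    refine ⟨⌊s ^ 2 / 10⌋₊, ?_, Nat.floor_le (by positivity)⟩
    have := Nat.lt_floor_add_one (s ^ 2 / 10)
    linarith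
  have h := real_hasCliqueLinkedCycle_le_clique (V := Fin n) p t
  rw [Fintype.card_fin] at h
  set μ := (binomialRandom (Fin n) p).real {Γ | Γ.HasCliqueLinkedCycle} with hμ
  have hμ0 : 0 ≤ μ := measureReal_nonneg
  set x : ℝ := p.1 with hx
  obtain ⟨q, hqx⟩ : ∃ q : ℝ, q = 1 - x := ⟨_, rfl⟩
  have hxq : x = 1 - q := by linarith
  have hq0 : 0 ≤ q := by rw [hqx]; exact one_sub_coe_nonneg p
  have hq1 : q ≤ 1 / 2 := by linarith
  have hx0 : 0 ≤ x := by linarith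
  have hx1 : x ≤ 1 := by linarith
  have ht1' : (1 : ℝ) ≤ t := by linarith
  set T : ℝ := (t : ℝ) with hT
  set u := T * q with hu
  have hu0 : 0 ≤ u := by positivity
  have hsq : 1 ≤ s ^ 5 * q := by
    have h1 : (1 : ℝ) ^ 4 ≤ (s ^ 5 * q) ^ 4 := by
      have : (s ^ 5 * q) ^ 4 = (n : ℝ) ^ 5 * (1 - x) ^ 4 := by rw [← hsn, hqx]; ring
      rw [this]; linarith
    exact le_of_pow_le_pow_left₀ (by norm_num) (by positivity) h1
  have hus : 1 ≤ 20 * s ^ 3 * u := by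
    calc 1 ≤ s ^ 5 * q := hsq
      _ = 20 * s ^ 3 * (s ^ 2 / 20 * q) := by ring
      _ ≤ 20 * s ^ 3 * u := mul_le_mul_of_nonneg_left
        (mul_le_mul_of_nonneg_right ht1 hq0) (by positivity)
  have hq2 : q ^ 2 ≤ 1 := pow_le_one₀ hq0 (by linarith)
  -- From (1 - q)^t (1 + q)^t ≤ 1 and Bernoulli; the resulting 1 - x^t ≥ u/(1 + u) is useful for
  -- both small and large u.
  have hxt : x ^ t * (1 + u) ≤ 1 := by
    have h1 : 1 + u ≤ (1 + q) ^ t := one_add_mul_le_pow (by linarith) t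
    calc x ^ t * (1 + u) ≤ x ^ t * (1 + q) ^ t := by gcongr
      _ = (1 - q ^ 2) ^ t := by rw [← mul_pow, hxq]; ring
      _ ≤ 1 := pow_le_one₀ (by linarith) (by linarith [sq_nonneg q])
  have hxt' : u / (1 + u) ≤ 1 - x ^ t := by
    rw [div_le_iff₀ (by positivity)]
    linarith
  have hxt0 : 0 ≤ 1 - x ^ t := le_trans (by positivity) hxt'
  obtain ⟨C, hC⟩ : ∃ C, C = (t + 1).choose 2 := ⟨_, rfl⟩
  have hCt : (C : ℝ) ≤ T ^ 2 := by
    have h3 : (t + 1).choose 2 * 2 = (t + 1) * t := by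
      rw [Nat.choose_two_right, Nat.add_sub_cancel]
      exact Nat.div_mul_cancel (by simpa [mul_comm] using (Nat.even_mul_succ_self t).two_dvd)
    rw [← hC] at h3
    have h4 : (C : ℝ) * 2 = (T + 1) * T := by rw [hT]; exact_mod_cast h3
    linarith [le_self_pow₀ ht1' two_ne_zero]
  -- As 1 - q ≥ e^(-2q) for q ≤ 1/2, dividing by x^C costs at most e^(2uT).
  have hxC : 1 ≤ x ^ C * Real.exp (2 * u * T) := by
    have h1 : 1 ≤ x * Real.exp (2 * q) := by
      have := Real.add_one_le_exp (2 * q)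
      calc 1 ≤ x * (2 * q + 1) := by rw [hxq]; linarith [mul_nonneg hq0 (by linarith : 0 ≤ 1 - 2 * q)]
        _ ≤ _ := by gcongr
    calc 1 ≤ (x * Real.exp (2 * q)) ^ C := one_le_pow₀ h1
      _ = x ^ C * Real.exp (C * (2 * q)) := by rw [mul_pow, Real.exp_nat_mul]
      _ ≤ x ^ C * Real.exp (2 * u * T) := by
        refine mul_le_mul_of_nonneg_left (Real.exp_le_exp.2 ?_) (pow_nonneg hx0 _)
        calc (C : ℝ) * (2 * q) ≤ T ^ 2 * (2 * q) := by gcongr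
          _ = 2 * u * T := by rw [hu]; ring
  have hn2 : (n : ℝ) / 2 ≤ (n - 2 : ℕ) := by
    rw [Nat.cast_sub (by omega)]; push_cast; linarith
  have hexp : (n : ℝ) / 8 * (u / (1 + u)) ≤ x ^ 2 * (1 - x ^ t) * (n - 2 : ℕ) := by
    calc (n : ℝ) / 8 * (u / (1 + u)) = (1 / 2) ^ 2 * (u / (1 + u)) * (n / 2) := by ring
      _ ≤ x ^ 2 * (1 - x ^ t) * (n - 2 : ℕ) := by gcongr
  -- That cost uses at most half of the exponent in `hexp`; `hsu` bounds the other half below, using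
  -- u ≥ 1/(20 s³).
  have hut : 2 * u * T ≤ (n : ℝ) / 16 * (u / (1 + u)) := by
    have h1 : u ≤ T / 2 := by
      rw [hu, div_eq_mul_one_div]
      gcongr
    have h2 : 32 * T * (1 + u) ≤ n := by
      rw [← hsn]
      have : T ^ 2 ≤ s ^ 4 / 100 := by
        calc T ^ 2 ≤ (s ^ 2 / 10) ^ 2 := by gcongr
          _ = _ := by ring
      have h3 : T * u ≤ T * (T / 2) := by gcongr
      have h4 : T ≤ T ^ 2 := le_self_pow₀ ht1' two_ne_zero
      have h5 : 0 ≤ s ^ 4 := by positivity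
      linarith
    rw [mul_div_assoc', le_div_iff₀ (by positivity)]
    linarith [mul_le_mul_of_nonneg_left h2 hu0]
  have hsu : s / 640 ≤ (n : ℝ) / 16 * (u / (1 + u)) := by
    rw [mul_div_assoc', le_div_iff₀ (by positivity), ← hsn]
    have h20 : 20 ≤ 20 * s ^ 3 := by
      have : 1 ≤ s := (one_le_pow_iff_of_nonneg hs two_ne_zero).1 (by linarith)
      have := one_le_pow₀ this (n := 3)
      linarith
    have h1 : 1 + u ≤ 40 * s ^ 3 * u := by
      have := mul_le_mul_of_nonneg_right h20 hu0
      linarith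
    calc s / 640 * (1 + u) ≤ s / 640 * (40 * s ^ 3 * u) := by gcongr
      _ = s ^ 4 / 16 * u := by ring
  rw [← hC] at h
  calc μ = 1 * μ := (one_mul _).symm
    _ ≤ x ^ C * Real.exp (2 * u * T) * μ := by gcongr
    _ = Real.exp (2 * u * T) * (x ^ C * μ) := by ring
    _ ≤ Real.exp (2 * u * T) * ((n : ℝ) ^ 2 *
        Real.exp (-(x ^ 2 * (1 - x ^ t) * (n - 2 : ℕ)))) := by gcongr
    _ = (n : ℝ) ^ 2 * Real.exp (2 * u * T + -(x ^ 2 * (1 - x ^ t) * (n - 2 : ℕ))) := by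
      rw [Real.exp_add]; ring
    _ ≤ (n : ℝ) ^ 2 * Real.exp (-(s / 640)) := by
      gcongr
      linarith
    _ = s ^ 8 * Real.exp (-(s / 640)) := by rw [← hsn]; ring

lemma eventually_hasCliqueLinkedCycle_le_of_dense {δ : ℝ} (hδ : 0 < δ) :
    ∀ᶠ n : ℕ in atTop, ∀ p : I, (1 / 2 : ℝ) ≤ p → 1 < (n : ℝ) ^ 5 * (1 - p : ℝ) ^ 4 →
      (binomialRandom (Fin n) p).real {Γ | Γ.HasCliqueLinkedCycle} ≤ δ := by
  have h0 : Tendsto (fun n : ℕ ↦ (n : ℝ) ^ (1 / 4 : ℝ)) atTop atTop :=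
    (tendsto_rpow_atTop (by norm_num)).comp tendsto_natCast_atTop_atTop
  have h1 := (tendsto_rpow_mul_exp_neg_mul_atTop_nhds_zero 8 (1 / 640) (by norm_num)).comp h0
  filter_upwards [h1.eventually_le_const hδ, eventually_ge_atTop 400] with n hn hn4 p hp hq
  refine (real_hasCliqueLinkedCycle_le_of_dense hn4 (s := (n : ℝ) ^ (1 / 4 : ℝ)) (by positivity)
    ?_ p hp hq).trans (le_trans (le_of_eq ?_) hn)
  · rw [← Real.rpow_natCast, ← Real.rpow_mul (by positivity)]
    norm_num
  · simp only [Function.comp_apply]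
    norm_cast
    congr 2
    ring

/-- The clique bound with t = 1 suffices. The constant 4 gives p²(1 - p)(n - 2) ≥ 4 log n, so the
right side is at most n⁻², and dividing by p ≥ 1/n leaves 1/n. -/
lemma eventually_hasCliqueLinkedCycle_le_of_medium {δ : ℝ} (hδ : 0 < δ) :
    ∀ᶠ n : ℕ in atTop, ∀ p : I, 4 * Real.sqrt (Real.log n / n) ≤ p → (p : ℝ) ≤ 1 / 2 →
      (binomialRandom (Fin n) p).real {Γ | Γ.HasCliqueLinkedCycle} ≤ δ := by
  have h1 : ∀ᶠ n : ℕ in atTop, 1 / (n : ℝ) ≤ δ :=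
    tendsto_one_div_atTop_nhds_zero_nat.eventually_le_const hδ
  have h2 : ∀ᶠ n : ℕ in atTop, 1 ≤ Real.log n :=
    (Real.tendsto_log_atTop.comp tendsto_natCast_atTop_atTop).eventually_ge_atTop 1
  filter_upwards [h1, h2, eventually_ge_atTop 4] with n hn hL hn4 p hp hp2
  have hnR : (4 : ℝ) ≤ n := by exact_mod_cast hn4
  have h := real_hasCliqueLinkedCycle_le_clique (V := Fin n) p 1
  rw [Fintype.card_fin, show Nat.choose (1 + 1) 2 = 1 from rfl, pow_one] at h
  set μ := (binomialRandom (Fin n) p).real {Γ | Γ.HasCliqueLinkedCycle} with hμ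
  have hμ0 : 0 ≤ μ := measureReal_nonneg
  set x : ℝ := p.1 with hx
  have hr0 : 0 ≤ Real.sqrt (Real.log n / n) := Real.sqrt_nonneg _
  have hx2 : 16 * (Real.log n / n) ≤ x ^ 2 := by
    calc 16 * (Real.log n / n) = (4 * Real.sqrt (Real.log n / n)) ^ 2 := by
          rw [mul_pow, Real.sq_sqrt (by positivity)]; norm_num
      _ ≤ x ^ 2 := by gcongr
  have hx1 : 0 ≤ 1 - x := by linarith
  have hxn : 1 / (n : ℝ) ≤ x := by
    have : 1 / (n : ℝ) ≤ Real.sqrt (Real.log n / n) := by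
      apply Real.le_sqrt_of_sq_le
      rw [div_pow, one_pow, sq]
      gcongr
      nlinarith
    linarith
  have hn2 : (n : ℝ) / 2 ≤ (n - 2 : ℕ) := by
    rw [Nat.cast_sub (by omega)]; push_cast; linarith
  have hexp : 4 * Real.log n ≤ x ^ 2 * (1 - x) * (n - 2 : ℕ) := by
    calc 4 * Real.log n = 16 * (Real.log n / n) * (1 / 2) * (n / 2) := by field_simp; norm_num
      _ ≤ x ^ 2 * (1 - x) * (n - 2 : ℕ) := by
        gcongr
        linarith
  have he : Real.exp (-(4 * Real.log n)) = ((n : ℝ) ^ 4)⁻¹ := by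
    rw [Real.exp_neg, show (4 : ℝ) = (4 : ℕ) by norm_num, Real.exp_nat_mul,
      Real.exp_log (by positivity)]
  have hfin : 1 / (n : ℝ) * μ ≤ (n : ℝ) ^ 2 * ((n : ℝ) ^ 4)⁻¹ := by
    calc 1 / (n : ℝ) * μ ≤ x * μ := by gcongr
      _ ≤ _ := h
      _ ≤ _ := by
        rw [← he]
        exact mul_le_mul_of_nonneg_left (Real.exp_le_exp.2 (neg_le_neg hexp)) (by positivity)
  calc μ = n * (1 / (n : ℝ) * μ) := by field_simp
    _ ≤ n * ((n : ℝ) ^ 2 * ((n : ℝ) ^ 4)⁻¹) := by gcongr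
    _ = 1 / n := by field_simp
    _ ≤ δ := hn

lemma tendsto_sqrt_log_div_rpow {a : ℝ} (ha : 0 < a) :
    Tendsto (fun n : ℕ ↦ Real.sqrt (Real.log n / (n : ℝ) ^ a)) atTop (𝓝 0) := by
  have h := ((isLittleO_log_rpow_atTop ha).tendsto_div_nhds_zero).comp
    tendsto_natCast_atTop_atTop
  have h2 := (Real.continuous_sqrt.tendsto 0).comp h
  rw [Real.sqrt_zero] at h2
  exact h2

lemma eventually_hasCliqueLinkedCycle_le_of_sparse {c : ℝ} (hc0 : 0 < c) (hc : 1 / 2 < c ^ 2)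
    {δ : ℝ} (hδ : 0 < δ) :
    ∀ᶠ n : ℕ in atTop, ∀ p : I, c * Real.sqrt (Real.log n / n) ≤ p →
      (p : ℝ) ≤ 4 * Real.sqrt (Real.log n / n) →
      (binomialRandom (Fin n) p).real {Γ | Γ.HasCliqueLinkedCycle} ≤ δ := by
  -- The gap from c² to β absorbs the factors (1 - p)^j and (n - m)/n. With β = 1/2 + 2γ, the
  -- quantity n p n^(-β) is below n^(-γ) by a further power n^(-γ) up to √log n, and r ≥ 2/γ lets
  -- these spare factors absorb n².
  obtain ⟨β, hβ1, hβ2⟩ := exists_between hc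
  set γ := (β - 1 / 2) / 2 with hγ
  have hγ0 : 0 < γ := by rw [hγ]; linarith
  obtain ⟨r, hr⟩ := exists_nat_ge (2 / γ)
  rw [div_le_iff₀ hγ0] at hr
  have hr0 : r ≠ 0 := by rintro rfl; norm_num at hr
  have hsq0 : Tendsto (fun n : ℕ ↦ Real.sqrt (Real.log n / n)) atTop (𝓝 0) := by
    simpa using tendsto_sqrt_log_div_rpow one_pos
  let P : ℕ → ℝ := fun n ↦ 4 * Real.sqrt (Real.log n / n)
  have hP0 : Tendsto P atTop (𝓝 0) := by simpa only [mul_zero] using hsq0.const_mul 4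
  let y : ℕ → ℝ := fun n ↦ 4 * Real.sqrt (Real.log n / (n : ℝ) ^ (2 * γ))
  have hy : Tendsto y atTop (𝓝 0) := by
    simpa using (tendsto_sqrt_log_div_rpow (a := 2 * γ) (by positivity)).const_mul 4
  have hbound : Tendsto (fun n ↦ ∑ k ∈ Finset.Ico 5 (r + 2), y n ^ k + y n ^ r) atTop (𝓝 0) := by
    have h1 : Tendsto (fun n ↦ ∑ k ∈ Finset.Ico 5 (r + 2), y n ^ k) atTop
        (𝓝 (∑ k ∈ Finset.Ico 5 (r + 2), 0)) := by
      refine tendsto_finsetSum _ fun k hk ↦ ?_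
      have hk0 : k ≠ 0 := by have := (Finset.mem_Ico.1 hk).1; omega
      simpa [hk0] using hy.pow k
    have h2 : Tendsto (fun n ↦ y n ^ r) atTop (𝓝 0) := by simpa [hr0] using hy.pow r
    simpa using h1.add h2
  have hfrac : ∀ᶠ n : ℕ in atTop,
      β ≤ c ^ 2 * ((1 - P n) ^ r * (1 - (r + 2 : ℕ) * (1 / (n : ℝ)))) := by
    have h1 : Tendsto (fun n : ℕ ↦ c ^ 2 * ((1 - P n) ^ r * (1 - (r + 2 : ℕ) * (1 / (n : ℝ)))))
        atTop (𝓝 (c ^ 2 * ((1 - 0) ^ r * (1 - (r + 2 : ℕ) * 0)))) :=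
      (((hP0.const_sub 1).pow r).mul
        ((tendsto_one_div_atTop_nhds_zero_nat.const_mul _).const_sub 1)).const_mul _
    refine h1.eventually_const_le ?_
    simpa using hβ2
  filter_upwards [hbound.eventually_le_const hδ, hfrac, hP0.eventually_le_const one_pos,
    eventually_ge_atTop (r + 2)] with n hδn hfn hPn hn p hp1 hp2
  have hn1 : (1 : ℝ) ≤ n := by exact_mod_cast (by omega : 1 ≤ n)
  have hnpos : (0 : ℝ) < n := by linarith
  have hL : 0 ≤ Real.log n := Real.log_nonneg hn1
  have hr0' : 0 ≤ Real.sqrt (Real.log n / n) := Real.sqrt_nonneg _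
  have h := real_hasCliqueLinkedCycle_le_sparse (V := Fin n) p r
  rw [Fintype.card_fin] at h
  set x : ℝ := p.1 with hx
  have hx0 : 0 ≤ x := p.2.1
  have hx1 : x ≤ 1 := p.2.2
  have hx2 : c ^ 2 * (Real.log n / n) ≤ x ^ 2 := by
    calc c ^ 2 * (Real.log n / n) = (c * Real.sqrt (Real.log n / n)) ^ 2 := by
          rw [mul_pow, Real.sq_sqrt (by positivity)]
      _ ≤ x ^ 2 := by gcongr
  have hexp : ∀ j m : ℕ, j ≤ r → m ≤ r + 2 →
      β * Real.log n ≤ x ^ 2 * (1 - x) ^ j * (n - m : ℕ) := by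
    intro j m hj hm
    have h1 : (1 - P n) ^ r ≤ (1 - x) ^ j := by
      calc (1 - P n) ^ r ≤ (1 - x) ^ r :=
            pow_le_pow_left₀ (by linarith) (by linarith [show x ≤ P n from hp2]) r
        _ ≤ (1 - x) ^ j := pow_le_pow_of_le_one (by linarith) (by linarith) hj
    have h2 : (n : ℝ) * (1 - (r + 2 : ℕ) * (1 / (n : ℝ))) ≤ (n - m : ℕ) := by
      rw [Nat.cast_sub (by omega)]
      have : (m : ℝ) ≤ (r + 2 : ℕ) := by exact_mod_cast hm
      field_simp
      linarith
    have h3 : 0 ≤ (n : ℝ) * (1 - (r + 2 : ℕ) * (1 / (n : ℝ))) := by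
      have : ((r + 2 : ℕ) : ℝ) ≤ n := by exact_mod_cast hn
      have h4 : (n : ℝ) * (1 - (r + 2 : ℕ) * (1 / (n : ℝ))) = n - (r + 2 : ℕ) := by field_simp
      rw [h4]; linarith
    have hP1 : 0 ≤ 1 - P n := by linarith
    have hx1' : 0 ≤ 1 - x := by linarith
    calc β * Real.log n
        ≤ c ^ 2 * ((1 - P n) ^ r * (1 - (r + 2 : ℕ) * (1 / (n : ℝ)))) * Real.log n := by gcongr
      _ = c ^ 2 * (Real.log n / n) * (1 - P n) ^ r *
          (n * (1 - (r + 2 : ℕ) * (1 / (n : ℝ)))) := by field_simp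
      _ ≤ x ^ 2 * (1 - x) ^ j * (n - m : ℕ) := by gcongr
  have hterm : ∀ j m k : ℕ, j ≤ r → m ≤ r + 2 →
      Real.exp (-(k * (x ^ 2 * (1 - x) ^ j) * (n - m : ℕ))) ≤ ((n : ℝ) ^ (-β)) ^ k := by
    intro j m k hj hm
    have h1 : (n : ℝ) ^ (-β) = Real.exp (-(β * Real.log n)) := by
      rw [Real.rpow_def_of_pos hnpos]; congr 1; ring
    rw [h1, ← Real.exp_nat_mul]
    refine Real.exp_le_exp.2 ?_
    have := mul_le_mul_of_nonneg_left (hexp j m hj hm) (Nat.cast_nonneg (α := ℝ) k)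
    linarith
  set z := (n : ℝ) * x * (n : ℝ) ^ (-β) with hz
  have hz0 : 0 ≤ z := by positivity
  have hzy : z * (n : ℝ) ^ γ ≤ y n := by
    have h1 : Real.sqrt (Real.log n / (n : ℝ) ^ (2 * γ)) =
        Real.sqrt (Real.log n / n) * (n * (n : ℝ) ^ (-β) * (n : ℝ) ^ γ) := by
      have h2 : (n : ℝ) * (n : ℝ) ^ (-β) * (n : ℝ) ^ γ = (n : ℝ) ^ (1 / 2 - γ) := by
        nth_rewrite 1 [← Real.rpow_one (n : ℝ)]
        rw [← Real.rpow_add hnpos, ← Real.rpow_add hnpos]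
        congr 1
        rw [hγ]; ring
      have h3 : (n : ℝ) ^ (1 / 2 - γ) = Real.sqrt ((n : ℝ) ^ (1 - 2 * γ)) := by
        rw [Real.sqrt_eq_rpow, ← Real.rpow_mul hnpos.le]
        congr 1; ring
      rw [h2, h3, ← Real.sqrt_mul (by positivity), Real.rpow_sub hnpos, Real.rpow_one]
      congr 1
      field_simp
    calc z * (n : ℝ) ^ γ = x * (n * (n : ℝ) ^ (-β) * (n : ℝ) ^ γ) := by rw [hz]; ring
      _ ≤ 4 * Real.sqrt (Real.log n / n) * (n * (n : ℝ) ^ (-β) * (n : ℝ) ^ γ) := by gcongr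
      _ = y n := by simp only [y]; rw [h1]; ring
  have hnγ : 1 ≤ (n : ℝ) ^ γ := Real.one_le_rpow hn1 hγ0.le
  have hzy' : z ≤ y n := (le_mul_of_one_le_right hz0 hnγ).trans hzy
  refine (h.trans (add_le_add (Finset.sum_le_sum fun k hk ↦ ?_) ?_)).trans hδn
  · have hk' := Finset.mem_Ico.1 hk
    calc _ ≤ (n : ℝ) ^ k * (x ^ k * ((n : ℝ) ^ (-β)) ^ k) := by
          gcongr
          exact hterm _ _ _ (by omega) (by omega)
      _ = z ^ k := by rw [hz]; ring
      _ ≤ y n ^ k := by gcongr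
  · have hnr : (n : ℝ) ^ 2 ≤ ((n : ℝ) ^ γ) ^ r := by
      rw [← Real.rpow_natCast, ← Real.rpow_natCast, ← Real.rpow_mul hnpos.le]
      refine Real.rpow_le_rpow_of_exponent_le hn1 ?_
      push_cast
      linarith
    calc _ ≤ (n : ℝ) ^ (r + 2) * (x ^ r * ((n : ℝ) ^ (-β)) ^ r) := by
          gcongr ?_ * (?_ * ?_)
          -- A path has one more edge than interior vertices; that factor x is discarded.
          · exact pow_le_pow_of_le_one hx0 hx1 (by omega)
          · exact hterm _ _ _ le_rfl le_rfl
      _ = z ^ r * (n : ℝ) ^ 2 := by rw [hz]; ring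
      _ ≤ z ^ r * ((n : ℝ) ^ γ) ^ r := by gcongr
      _ = (z * (n : ℝ) ^ γ) ^ r := by ring
      _ ≤ y n ^ r := by gcongr

/-- Uniformity in `p` matters: p(n) may move between the four ranges as n grows. -/
lemma eventually_hasCliqueLinkedCycle_le {c : ℝ} (hc0 : 0 < c) (hc : 1 / 2 < c ^ 2)
    {δ : ℝ} (hδ : 0 < δ) :
    ∀ᶠ n : ℕ in atTop, ∀ p : I, c * Real.sqrt (Real.log n / n) ≤ p →
      (binomialRandom (Fin n) p).real {Γ | Γ.HasCliqueLinkedCycle} ≤ δ := by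
  filter_upwards [eventually_hasCliqueLinkedCycle_le_of_few_nonedges hδ,
    eventually_hasCliqueLinkedCycle_le_of_dense hδ,
    eventually_hasCliqueLinkedCycle_le_of_medium hδ,
    eventually_hasCliqueLinkedCycle_le_of_sparse hc0 hc hδ] with n h1 h2 h3 h4 p hp
  rcases le_total (p : ℝ) (4 * Real.sqrt (Real.log n / n)) with h | h
  · exact h4 p hp h
  rcases le_total (p : ℝ) (1 / 2) with h' | h'
  · exact h3 p h h'
  rcases le_or_gt ((n : ℝ) ^ 5 * (1 - p : ℝ) ^ 4) 1 with h'' | h''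
  · exact h1 p h''
  · exact h2 p h' h''

end Asymptotics

end SimpleGraph

theorem proposition3p4 (ε : ℝ) (hε : 0 < ε) (p : ℕ → unitInterval)
    (hp : ∀ᶠ n : ℕ in atTop,
      (Real.sqrt (1 / 2) + ε) * Real.sqrt (Real.log (n : ℝ) / (n : ℝ)) < (p n : ℝ)) :
    AsymptoticallyAlmostSurely p
      (fun _ Γ => ∀ k : ℕ, 5 ≤ k → ¬ ∃ Λ : Γ.Subgraph, Λ.IsMorseCycle k) := by
  have hs : 0 < Real.sqrt (1 / 2) := Real.sqrt_pos.2 (by norm_num)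
  have hc : 1 / 2 < (Real.sqrt (1 / 2) + ε) ^ 2 := by
    have := Real.sq_sqrt (show (0 : ℝ) ≤ 1 / 2 by norm_num)
    nlinarith
  unfold AsymptoticallyAlmostSurely
  set good : ∀ n : ℕ, Set (SimpleGraph (Fin n)) :=
    fun n ↦ {Γ | ∀ k : ℕ, 5 ≤ k → ¬ ∃ Λ : Γ.Subgraph, Λ.IsMorseCycle k} with hgood
  -- Subadditivity alone bounds the good event below, so no measurability is needed.
  have hcover : ∀ n, 1 ≤ (SimpleGraph.binomialRandom (Fin n) (p n)).real (good n) +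
      (SimpleGraph.binomialRandom (Fin n) (p n)).real {Γ | Γ.HasCliqueLinkedCycle} := by
    intro n
    have hu : good n ∪ {Γ | Γ.HasCliqueLinkedCycle} = Set.univ := by
      refine Set.eq_univ_of_forall fun Γ ↦ ?_
      by_cases h : Γ.HasCliqueLinkedCycle
      · exact Or.inr h
      · refine Or.inl fun k hk ⟨Λ, hΛ⟩ ↦ h ⟨k, hk, SimpleGraph.exists_isCliqueLinkedCycle hk hΛ⟩
    have := MeasureTheory.measureReal_union_le
      (μ := SimpleGraph.binomialRandom (Fin n) (p n)) (good n) {Γ | Γ.HasCliqueLinkedCycle}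
    rwa [hu, MeasureTheory.probReal_univ] at this
  have hreal : Tendsto (fun n ↦ (SimpleGraph.binomialRandom (Fin n) (p n)).real (good n)) atTop
      (𝓝 1) := by
    rw [Metric.tendsto_nhds]
    intro δ hδ
    filter_upwards [hp, SimpleGraph.eventually_hasCliqueLinkedCycle_le
      (c := Real.sqrt (1 / 2) + ε) (by positivity) hc (half_pos hδ)] with n h1 h2
    have h3 := h2 (p n) h1.le
    have h4 : (SimpleGraph.binomialRandom (Fin n) (p n)).real (good n) ≤ 1 :=
      MeasureTheory.measureReal_le_one
    rw [Real.dist_eq, abs_lt]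
    constructor <;> linarith [hcover n]
  have hlim : Tendsto (fun n ↦ SimpleGraph.binomialRandom (Fin n) (p n) (good n)) atTop (𝓝 1) := by
    simpa using ENNReal.tendsto_ofReal hreal
  exact hlim
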